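/- Write $C^\infty_n$ for the smooth functions $\mathbb{R}\to\mathbb{R}^n$; all polynomials are univariate with real coefficients. Fix $m,p\ge 0$. Inputs are $u\in C^\infty_m$ and outputs are $y\in C^\infty_p$. **Systems.** An environment, or assumptions, is a system $A:\ 0=A(\tfrac{d}{dt})u$ with $A(s)$ a polynomial matrix with $m$ columns; its input behaviour is $\mathcal{B}_i(A)=\{u\in C^\infty_m : A(\tfrac{d}{dt})u=0\}$. Guarantees are a system $\Gamma:\ G(\tfrac{d}{dt})y=H(\tfrac{d}{dt})u$ with $G(s),H(s)$ polynomial matrices; its external behaviour is $\mathcal{B}(\Gamma)=\{(u,y)\in C^\infty_m\times C^\infty_p : G(\tfrac{d}{dt})y=H(\tfrac{d}{dt})u\}$. A system in input-output form is $\Sigma:\ P(\tfrac{d}{dt})y=Q(\tfrac{d}{dt})u$ with $P(s)$ a $p\times p$ and $Q(s)$ a $p\times m$ polynomial matrix such that $P(s)$ is invertible as a rational matrix and $P(s)^{-1}Q(s)$ is proper. For a system $E:\ 0=E(\tfrac{d}{dt})u$ and a system $S$ (either $\Sigma$ or $\Gamma$), the interconnection $E\wedge S$ consists of the equations of $S$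 together with $0=E(\tfrac{d}{dt})u$. **Contracts.** A contract is a pair $\mathcal{C}=(A,\Gamma)$ of assumptions and guarantees. An environment $E$ is compatible with $\mathcal{C}$ if $\mathcal{B}_i(E)\subseteq\mathcal{B}_i(A)$. A system $\Sigma$ in input-output form implements $\mathcal{C}$ if $\mathcal{B}(E\wedge\Sigma)\subseteq\mathcal{B}(\Gamma)$ for every environment $E$ compatible with $\mathcal{C}$. The contract $\mathcal{C}$ refines $\mathcal{C}'$ if every environment compatible with $\mathcal{C}'$ is compatible with $\mathcal{C}$ and every implementation of $\mathcal{C}$ is an implementation of $\mathcal{C}'$. The conjunction $\mathcal{C}_1\wedge\mathcal{C}_2$ is the largest contract refining both $\mathcal{C}_1$ and $\mathcal{C}_2$: a contract that refines both and is refined by every contract that refines both. (It need not exist; when it does, it is unique up to mutual refinement.) **Join and meet.** The join $A_1\vee A_2$ is the system with latent variables $l_1,l_2\in C^\infty_m$ and equations $$l_1+l_2=u,\qquad A_1(\tfrac{d}{dt})l_1=0,\qquad A_2(\tfrac{d}{dt})l_2=0;$$ its input behaviour $\mathcal{B}_i(A_1\vee A_2)$ is the set of $u\in C^\infty_m$ for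 which such $l_1,l_2$ exist. The meet $\Gamma_1\wedge\Gamma_2$ consists of the equations of $\Gamma_1$ together with those of $\Gamma_2$. **Theorem.** Let $\mathcal{C}_1=(A_1,\Gamma_1)$ and $\mathcal{C}_2=(A_2,\Gamma_2)$ be contracts. Then there are assumptions of the form $0=A(\tfrac{d}{dt})u$ that represent the join, that is, with $\mathcal{B}_i(A)=\mathcal{B}_i(A_1\vee A_2)$. Let $A_1\vee A_2$ also denote any such assumptions. If at least one of the conditions 1. $\mathcal{B}_i(A_1)=\mathcal{B}_i(A_2)$; 2. $\mathcal{B}((A_1\vee A_2)\wedge\Gamma_1)=\mathcal{B}((A_1\vee A_2)\wedge\Gamma_2)$ holds, then the conjunction of $\mathcal{C}_1$ and $\mathcal{C}_2$ exists and is given by $$\mathcal{C}_1\wedge\mathcal{C}_2=(A_1\vee A_2,\ \Gamma_1\wedge\Gamma_2).$$ -/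

import Mathlib

open Polynomial
open scoped ContDiff

noncomputable section

namespace LinearContracts

/-- Smooth functions `ℝ → ℝ^ι`. -/
def cInf (ι : Type) [Fintype ι] : Set (ℝ → ι → ℝ) :=
  {w | ContDiff ℝ ∞ w}

/-- `q(d/dt) f = ∑ₖ qₖ f⁽ᵏ⁾` for a scalar polynomial `q(s) = ∑ₖ qₖ sᵏ`. -/
def diffOp (q : ℝ[X]) (f : ℝ → ℝ) : ℝ → ℝ :=
  fun t => q.sum fun k a => a * iteratedDeriv k f t

/-- `R(d/dt) w` for a polynomial matrix `R(s)`. -/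
def matDiffOp {ρ ι : Type} [Fintype ι] (R : Matrix ρ ι ℝ[X]) (w : ℝ → ι → ℝ) :
    ℝ → ρ → ℝ :=
  fun t i => ∑ j, diffOp (R i j) (fun τ => w τ j) t

/-- A system `0 = E(d/dt) u` involving inputs only: an environment, or assumptions. -/
structure InputSystem (m : ℕ) where
  rows : Type
  [fintypeRows : Fintype rows]
  E : Matrix rows (Fin m) ℝ[X]

attribute [instance] InputSystem.fintypeRows

/-- The input behaviour of `0 = E(d/dt) u`. -/
def InputSystem.inputBehaviour {m : ℕ} (S : InputSystem m) : Set (ℝ → Fin m → ℝ) :=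
  {u | u ∈ cInf (Fin m) ∧ 0 = matDiffOp S.E u}

/-- A system `L(d/dt) l = M(d/dt) u` with latent variable `l`. -/
structure LatentInputSystem (m : ℕ) where
  rows : Type
  [fintypeRows : Fintype rows]
  latent : Type
  [fintypeLatent : Fintype latent]
  L : Matrix rows latent ℝ[X]
  M : Matrix rows (Fin m) ℝ[X]

attribute [instance] LatentInputSystem.fintypeRows LatentInputSystem.fintypeLatent

/-- The input behaviour of `L(d/dt) l = M(d/dt) u`: the projection onto `u`. -/
def LatentInputSystem.inputBehaviour {m : ℕ} (S : LatentInputSystem m) :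
    Set (ℝ → Fin m → ℝ) :=
  {u | u ∈ cInf (Fin m) ∧ ∃ l ∈ cInf S.latent, matDiffOp S.L l = matDiffOp S.M u}

/-- The join `A₁ ∨ A₂`, with latent variables `l₁`, `l₂`:
`[I I; A₁(d/dt) 0; 0 A₂(d/dt)] [l₁; l₂] = [I; 0; 0] u`. -/
def InputSystem.join {m : ℕ} (S₁ S₂ : InputSystem m) : LatentInputSystem m where
  rows := Fin m ⊕ (S₁.rows ⊕ S₂.rows)
  latent := Fin m ⊕ Fin m
  L := Matrix.fromRows (Matrix.fromCols 1 1) (Matrix.fromBlocks S₁.E 0 0 S₂.E)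
  M := Matrix.fromRows 1 0

/-- `S` has the form `0 = A(d/dt) u` and represents the input behaviour of the
latent variable system `T`. -/
def InputSystem.Represents {m : ℕ} (S : InputSystem m) (T : LatentInputSystem m) : Prop :=
  S.inputBehaviour = T.inputBehaviour

/-- A system `G(d/dt) y = H(d/dt) u`. -/
structure ExternalSystem (m p : ℕ) where
  rows : Type
  [fintypeRows : Fintype rows]
  G : Matrix rows (Fin p) ℝ[X]
  H : Matrix rows (Fin m) ℝ[X]

attribute [instance] ExternalSystem.fintypeRows

/-- The external behaviour of `G(d/dt) y = H(d/dt) u`. -/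
def ExternalSystem.behaviour {m p : ℕ} (S : ExternalSystem m p) :
    Set ((ℝ → Fin m → ℝ) × (ℝ → Fin p → ℝ)) :=
  {w | w.1 ∈ cInf (Fin m) ∧ w.2 ∈ cInf (Fin p) ∧ matDiffOp S.G w.2 = matDiffOp S.H w.1}

/-- The interconnection `E ∧ S`: `[G(d/dt); 0] y = [H(d/dt); E(d/dt)] u`. -/
def interconnect {m p : ℕ} (E : InputSystem m) (S : ExternalSystem m p) :
    ExternalSystem m p where
  rows := S.rows ⊕ E.rows
  G := Matrix.fromRows S.G 0
  H := Matrix.fromRows S.H E.E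

/-- The meet `Γ₁ ∧ Γ₂`: `[G₁(d/dt); G₂(d/dt)] y = [H₁(d/dt); H₂(d/dt)] u`. -/
def ExternalSystem.meet {m p : ℕ} (S₁ S₂ : ExternalSystem m p) : ExternalSystem m p where
  rows := S₁.rows ⊕ S₂.rows
  G := Matrix.fromRows S₁.G S₂.G
  H := Matrix.fromRows S₁.H S₂.H

/-- A polynomial matrix regarded as a rational matrix. -/
def toRational {ρ ι : Type} (R : Matrix ρ ι ℝ[X]) : Matrix ρ ι (RatFunc ℝ) :=
  R.map (algebraMap ℝ[X] (RatFunc ℝ))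

/-- A rational matrix is proper if in each entry the degree of the denominator is at least
the degree of the numerator. -/
def IsProper {ρ ι : Type} (R : Matrix ρ ι (RatFunc ℝ)) : Prop :=
  ∀ i j, (R i j).num.degree ≤ (R i j).denom.degree

/-- A system `P(d/dt) y = Q(d/dt) u` in input-output form. -/
structure IOSystem (m p : ℕ) where
  P : Matrix (Fin p) (Fin p) ℝ[X]
  Q : Matrix (Fin p) (Fin m) ℝ[X]
  invertible : ∃ R : Matrix (Fin p) (Fin p) (RatFunc ℝ), toRational P * R = 1
  proper : IsProper ((toRational P)⁻¹ * toRational Q)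

/-- The equations `P(d/dt) y = Q(d/dt) u` of a system in input-output form. -/
def IOSystem.toExternalSystem {m p : ℕ} (S : IOSystem m p) : ExternalSystem m p where
  rows := Fin p
  G := S.P
  H := S.Q

/-- A contract: a pair of assumptions and guarantees. -/
structure Contract (m p : ℕ) where
  assumptions : InputSystem m
  guarantees : ExternalSystem m p

/-- The environment `E` is compatible with the contract `C`. -/
def Contract.Compatible {m p : ℕ} (C : Contract m p) (E : InputSystem m) : Prop :=
  E.inputBehaviour ⊆ C.assumptions.inputBehaviour

/-- The system `S` in input-output form implements the contract `C`. -/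
def Contract.Implements {m p : ℕ} (C : Contract m p) (S : IOSystem m p) : Prop :=
  ∀ E : InputSystem m, C.Compatible E →
    (interconnect E S.toExternalSystem).behaviour ⊆ C.guarantees.behaviour

/-- `C₁` refines `C₂`. -/
def Contract.Refines {m p : ℕ} (C₁ C₂ : Contract m p) : Prop :=
  (∀ E : InputSystem m, C₂.Compatible E → C₁.Compatible E) ∧
    ∀ S : IOSystem m p, C₁.Implements S → C₂.Implements S

/-- `C` is the conjunction of `C₁` and `C₂`: it refines both of them, and it is refined by
every contract that refines both of them. -/
def Contract.IsConjunction {m p : ℕ} (C C₁ C₂ : Contract m p) : Prop :=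
  C.Refines C₁ ∧ C.Refines C₂ ∧
    ∀ C' : Contract m p, C'.Refines C₁ → C'.Refines C₂ → C'.Refines C

end LinearContracts

end

open Polynomial Module
open scoped ContDiff

noncomputable section

namespace LinearContracts

/-! Let `s` act on smooth functions as `d/dt`. Nonzero scalar operators are surjective, so this
`ℝ[s]`-module is divisible and, over a PID, injective (`SmoothModule.baer`). Hence a linear system
is solvable as soon as its right hand side satisfies every syzygy of the coefficient matrix
(`exists_matAction_eq_iff`). Two consequences matter: latent variables can be eliminated, since
syzygy modules are finitely generated, and a system in input-output form has an output for every
input.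

The join of the assumptions is the sum of their behaviours, the least behaviour containing both. For
an implementation of a common refinement, an input `u₁ + u₂` has its output split accordingly, and
linearity of the guarantees passes them from the summands to the sum. This needs each `Γᵢ` under
both assumptions, whereas refinement gives it only under `Aᵢ`; either of the two alternative
conditions supplies the cross cases. -/

/-! ### Surjectivity of scalar differential operators -/

/-- The space of smooth functions from `ℝ` to `𝕜`. -/
def smoothFun (𝕜 : Type) [RCLike 𝕜] : Submodule 𝕜 (ℝ → 𝕜) where
  carrier := {f | ContDiff ℝ ∞ f}
  add_mem' hf hg := ContDiff.add (id hf : ContDiff ℝ ∞ _) (id hg : ContDiff ℝ ∞ _)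
  zero_mem' := (contDiff_const : ContDiff ℝ ∞ fun _ : ℝ => (0 : 𝕜))
  smul_mem' c _ hf := ContDiff.const_smul c (id hf : ContDiff ℝ ∞ _)

theorem contDiff_smoothFun {𝕜 : Type} [RCLike 𝕜] (f : smoothFun 𝕜) : ContDiff ℝ ∞ f.1 :=
  f.2

theorem differentiable_smoothFun {𝕜 : Type} [RCLike 𝕜] (f : smoothFun 𝕜) :
    Differentiable ℝ f.1 :=
  (contDiff_smoothFun f).differentiable (by simp)

/-- Differentiation as an endomorphism of the space of smooth functions. -/
def smoothDeriv (𝕜 : Type) [RCLike 𝕜] : End 𝕜 (smoothFun 𝕜) where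
  toFun f := ⟨deriv f.1, (contDiff_infty_iff_deriv.mp (contDiff_smoothFun f)).2⟩
  map_add' f g := by
    ext t
    exact deriv_add (differentiable_smoothFun f t) (differentiable_smoothFun g t)
  map_smul' c f := by
    ext t
    exact deriv_const_smul c (differentiable_smoothFun f t)

theorem smoothDeriv_pow_apply {𝕜 : Type} [RCLike 𝕜] (k : ℕ) (f : smoothFun 𝕜) :
    ((smoothDeriv 𝕜 ^ k) f).1 = iteratedDeriv k f.1 := by
  induction k with
  | zero => simp
  | succ k ih =>
    rw [pow_succ', Module.End.mul_apply, iteratedDeriv_succ, ← ih]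
    rfl

/-- Integrating factor: `exp (a t) ∫₀ᵗ exp (-a s) f(s) ds` solves `g' - a g = f`. -/
theorem smoothDeriv_sub_const_surjective (a : ℂ) :
    Function.Surjective (smoothDeriv ℂ - algebraMap ℂ (End ℂ (smoothFun ℂ)) a) := by
  intro f
  set h : ℝ → ℂ := fun s => Complex.exp (-a * s) * f.1 s with hh
  have hexp (b : ℂ) : ContDiff ℝ ∞ fun s : ℝ => Complex.exp (b * s) :=
    (contDiff_const.mul Complex.ofRealCLM.contDiff).cexp
  have hsm : ContDiff ℝ ∞ h := (hexp (-a)).mul (contDiff_smoothFun f)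
  set F : ℝ → ℂ := fun t => ∫ s in (0 : ℝ)..t, h s
  have hF (t : ℝ) : HasDerivAt F (h t) t :=
    (hsm.continuous.integral_hasStrictDerivAt 0 t).hasDerivAt
  have hFsm : ContDiff ℝ ∞ F :=
    contDiff_infty_iff_deriv.mpr
      ⟨fun t => (hF t).differentiableAt, by rwa [funext fun t => (hF t).deriv]⟩
  refine ⟨⟨fun t => Complex.exp (a * t) * F t, (hexp a).mul hFsm⟩, ?_⟩
  ext t
  have he : HasDerivAt (fun t : ℝ => Complex.exp (a * t)) (Complex.exp (a * t) * (a * 1)) t :=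
    ((Complex.ofRealCLM.hasDerivAt (x := t)).const_mul a).cexp
  have hd := (he.mul (hF t)).deriv
  change deriv ((fun t : ℝ => Complex.exp (a * t)) * F) t - a * (Complex.exp (a * t) * F t) = f.1 t
  have hone : Complex.exp (a * t) * Complex.exp (-a * t) = 1 := by
    rw [← Complex.exp_add]
    simp
  rw [hd, hh]
  linear_combination f.1 t * hone

/-- Over `ℂ` the operator is a nonzero constant times a composite of first-order factors. -/
theorem aeval_smoothDeriv_complex_surjective {q : ℂ[X]} (hq : q ≠ 0) :
    Function.Surjective (aeval (smoothDeriv ℂ) q) := by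
  rw [(IsAlgClosed.splits q).eq_prod_roots, map_mul]
  refine Function.Surjective.comp (g := aeval (smoothDeriv ℂ) (C q.leadingCoeff)) ?_ ?_
  · intro f
    refine ⟨q.leadingCoeff⁻¹ • f, ?_⟩
    rw [aeval_C, Module.algebraMap_end_apply, smul_inv_smul₀ (leadingCoeff_ne_zero.mpr hq)]
  · induction q.roots using Multiset.induction with
    | empty => exact fun f => ⟨f, by simp⟩
    | cons a s ih =>
      rw [Multiset.map_cons, Multiset.prod_cons, map_mul]
      refine Function.Surjective.comp (g := aeval (smoothDeriv ℂ) (X - C a)) ?_ ih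
      simpa using smoothDeriv_sub_const_surjective a

/-- The pointwise real part of a smooth function. -/
def smoothRe : smoothFun ℂ →+ smoothFun ℝ where
  toFun g := ⟨fun t => (g.1 t).re, Complex.reCLM.contDiff.comp (contDiff_smoothFun g)⟩
  map_zero' := rfl
  map_add' _ _ := rfl

theorem smoothRe_deriv (g : smoothFun ℂ) :
    smoothRe (smoothDeriv ℂ g) = smoothDeriv ℝ (smoothRe g) := by
  ext t
  exact (Complex.reCLM.hasFDerivAt.comp_hasDerivAt t (differentiable_smoothFun g t).hasDerivAt).deriv.symm

theorem smoothRe_deriv_pow (k : ℕ) (g : smoothFun ℂ) :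
    smoothRe ((smoothDeriv ℂ ^ k) g) = (smoothDeriv ℝ ^ k) (smoothRe g) := by
  induction k with
  | zero => rfl
  | succ k ih =>
    rw [pow_succ', pow_succ', Module.End.mul_apply, Module.End.mul_apply, smoothRe_deriv, ih]

/-- Real coefficients commute with taking real parts, so a complex solution of a real equation
yields a real one. -/
theorem smoothRe_aeval (q : ℝ[X]) (g : smoothFun ℂ) :
    smoothRe (aeval (smoothDeriv ℂ) (q.map Complex.ofRealHom) g) =
      aeval (smoothDeriv ℝ) q (smoothRe g) := by
  induction q using Polynomial.induction_on' with
  | add p q hp hq =>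
    rw [Polynomial.map_add, map_add, map_add, LinearMap.add_apply, LinearMap.add_apply,
      map_add, hp, hq]
  | monomial k a =>
    rw [map_monomial, aeval_monomial, aeval_monomial, Module.End.mul_apply, Module.End.mul_apply,
      ← smoothRe_deriv_pow]
    ext t
    exact Complex.re_ofReal_mul _ _

/-- A nonzero scalar differential operator is surjective on smooth functions. -/
theorem aeval_smoothDeriv_real_surjective {q : ℝ[X]} (hq : q ≠ 0) :
    Function.Surjective (aeval (smoothDeriv ℝ) q) := by
  intro f
  obtain ⟨g, hg⟩ := aeval_smoothDeriv_complex_surjective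
    ((Polynomial.map_ne_zero_iff Complex.ofRealHom.injective).mpr hq)
    ⟨fun t => (f.1 t : ℂ), Complex.ofRealCLM.contDiff.comp (contDiff_smoothFun f)⟩
  refine ⟨smoothRe g, ?_⟩
  rw [← smoothRe_aeval, hg]
  rfl

/-! ### Injectivity and solvability of linear systems -/

/-- A divisible module over a principal ideal domain satisfies Baer's criterion. -/
theorem baer_of_smul_surjective {R V : Type*} [CommRing R] [IsDomain R] [IsPrincipalIdealRing R]
    [AddCommGroup V] [Module R V]
    (h : ∀ r : R, r ≠ 0 → Function.Surjective fun v : V => r • v) : Module.Baer R V := by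
  intro I g
  obtain ⟨a, rfl⟩ := (IsPrincipalIdealRing.principal I).principal
  have ha : a ∈ R ∙ a := Submodule.mem_span_singleton_self a
  -- The ideal is generated by `a`, so extending `g` amounts to dividing its value at `a` by `a`.
  obtain ⟨v, hv⟩ : ∃ v : V, a • v = g ⟨a, ha⟩ := by
    by_cases h0 : a = 0
    · refine ⟨0, ?_⟩
      have : (⟨a, ha⟩ : R ∙ a) = 0 := Subtype.ext h0
      rw [this, map_zero, smul_zero]
    · exact h a h0 _
  refine ⟨LinearMap.toSpanSingleton R V v, fun x hx => ?_⟩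
  obtain ⟨c, rfl⟩ := Submodule.mem_span_singleton.mp hx
  rw [LinearMap.toSpanSingleton_apply, smul_assoc, hv, ← map_smul]
  rfl

/-- Over a module satisfying Baer's criterion, a linear system is solvable as soon as its right
hand side satisfies all relations between the rows of the coefficient matrix. -/
theorem exists_solution_of_syzygies {R V ρ κ : Type*} [CommRing R] [AddCommGroup V] [Module R V]
    [Fintype ρ] [Fintype κ] (hV : Module.Baer R V) (L : Matrix ρ κ R) (w : ρ → V)
    (hw : ∀ r : ρ → R, Matrix.vecMul r L = 0 → ∑ i, r i • w i = 0) :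
    ∃ l : κ → V, ∀ i, ∑ j, L i j • l j = w i := by
  classical
  set f := L.vecMulLinear
  set φ := Fintype.linearCombination R w with hφ
  have hker : LinearMap.ker f ≤ LinearMap.ker φ := fun r hr => hw r hr
  -- `φ` factors through the row space of `L`, which embeds in `κ → R`; injectivity of `V` extends
  -- it there. The values on the standard basis form the solution.
  obtain ⟨g, hg⟩ := hV.extension_property ((LinearMap.ker f).liftQ f le_rfl)
    (LinearMap.ker_eq_bot.mp (Submodule.ker_liftQ_eq_bot _ _ _ le_rfl))
    ((LinearMap.ker f).liftQ φ hker)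
  have hgf (r : ρ → R) : g (f r) = φ r := by
    simpa using LinearMap.congr_fun hg (Submodule.Quotient.mk r)
  refine ⟨fun j => g (Pi.single j 1), fun i => ?_⟩
  have hi : f (Pi.single i 1) = ∑ j, L i j • (Pi.single j 1 : κ → R) := by
    rw [← pi_eq_sum_univ']
    exact Matrix.single_one_vecMul _ _
  have := hgf (Pi.single i 1)
  rw [hi, map_sum] at this
  simpa [hφ, Fintype.linearCombination_apply_single] using this

/-! ### Trajectories as vectors over the module of smooth functions -/

/-- Smooth functions as a module over `ℝ[s]`, where `s` acts as `d/dt`. -/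
abbrev SmoothModule : Type :=
  AEval' (smoothDeriv ℝ)

instance : IsLeftCancelAdd SmoothModule :=
  inferInstanceAs (IsLeftCancelAdd (smoothFun ℝ))

theorem SmoothModule.baer : Module.Baer ℝ[X] SmoothModule :=
  baer_of_smul_surjective fun _ hq v => by
    obtain ⟨f, hf⟩ := aeval_smoothDeriv_real_surjective hq ((AEval'.of (smoothDeriv ℝ)).symm v)
    exact ⟨AEval'.of _ f, ((AEval.of_aeval_smul _ _ _).symm.trans
      (congrArg (AEval'.of _) hf)).trans (LinearEquiv.apply_symm_apply _ _)⟩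

/-- The vector-valued function whose components are the given smooth functions. -/
def trajectory {ι : Type} (w : ι → SmoothModule) : ℝ → ι → ℝ :=
  fun t j => ((AEval'.of (smoothDeriv ℝ)).symm (w j)).1 t

theorem trajectory_injective {ι : Type} :
    Function.Injective (trajectory : (ι → SmoothModule) → ℝ → ι → ℝ) := by
  intro v w h
  ext1 j
  exact (AEval'.of (smoothDeriv ℝ)).symm.injective
    (Subtype.ext (funext fun t => congrFun (congrFun h t) j))

theorem trajectory_zero {ι : Type} : trajectory (0 : ι → SmoothModule) = 0 := rfl

theorem trajectory_mem_cInf {ι : Type} [Fintype ι] (w : ι → SmoothModule) :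
    trajectory w ∈ cInf ι :=
  contDiff_pi.mpr fun _ => contDiff_smoothFun _

theorem exists_trajectory_eq {ι : Type} [Fintype ι] {u : ℝ → ι → ℝ} (hu : u ∈ cInf ι) :
    ∃ w : ι → SmoothModule, trajectory w = u :=
  ⟨fun j => AEval'.of (smoothDeriv ℝ) ⟨fun t => u t j, contDiff_pi.mp (id hu : ContDiff ℝ ∞ u) j⟩, rfl⟩

theorem diffOp_eq_aeval (q : ℝ[X]) (f : smoothFun ℝ) :
    diffOp q f.1 = (aeval (smoothDeriv ℝ) q f).1 := by
  ext t
  rw [aeval_eq_sum_range, LinearMap.sum_apply, Submodule.coe_sum, Finset.sum_apply, diffOp,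
    sum_over_range _ fun _ => zero_mul _]
  refine Finset.sum_congr rfl fun k _ => ?_
  rw [← smoothDeriv_pow_apply]
  rfl

/-- A polynomial matrix acting on vectors over a module. -/
def matAction {ρ ι : Type} [Fintype ι] (R : Matrix ρ ι ℝ[X]) :
    (ι → SmoothModule) →ₗ[ℝ[X]] ρ → SmoothModule :=
  LinearMap.pi fun i => ∑ j, R i j • LinearMap.proj j

theorem matAction_apply {ρ ι : Type} [Fintype ι] (R : Matrix ρ ι ℝ[X]) (w : ι → SmoothModule)
    (i : ρ) : matAction R w i = ∑ j, R i j • w j := by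
  simp [matAction]

theorem matDiffOp_trajectory {ρ ι : Type} [Fintype ι] (R : Matrix ρ ι ℝ[X])
    (w : ι → SmoothModule) : matDiffOp R (trajectory w) = trajectory (matAction R w) := by
  ext t i
  simp only [matDiffOp, trajectory, matAction_apply, map_sum, Submodule.coe_sum, Finset.sum_apply]
  refine Finset.sum_congr rfl fun j _ => ?_
  exact congrFun (diffOp_eq_aeval _ _) t

theorem matAction_fromRows {ρ σ ι : Type} [Fintype ι] (R : Matrix ρ ι ℝ[X])
    (S : Matrix σ ι ℝ[X]) (w : ι → SmoothModule) :
    matAction (Matrix.fromRows R S) w = Sum.elim (matAction R w) (matAction S w) := by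
  ext (i | i) <;> simp [matAction_apply]

theorem matAction_fromCols {ρ ι κ : Type} [Fintype ι] [Fintype κ] (R : Matrix ρ ι ℝ[X])
    (S : Matrix ρ κ ℝ[X]) (w : ι ⊕ κ → SmoothModule) :
    matAction (Matrix.fromCols R S) w = matAction R (w ∘ Sum.inl) + matAction S (w ∘ Sum.inr) := by
  ext i
  simp [matAction_apply]

theorem matAction_zero {ρ ι : Type} [Fintype ι] (w : ι → SmoothModule) :
    matAction (0 : Matrix ρ ι ℝ[X]) w = 0 := by
  ext i
  simp [matAction_apply]

theorem matAction_one {ι : Type} [Fintype ι] [DecidableEq ι] (w : ι → SmoothModule) :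
    matAction (1 : Matrix ι ι ℝ[X]) w = w := by
  ext i
  simp [matAction_apply, Matrix.one_apply, ite_smul]

/-! ### Behaviours and elimination of latent variables -/

/-- A system with latent variables can be solved for these if and only if the right hand side
satisfies all relations between the rows of the coefficient matrix. -/
theorem exists_matAction_eq_iff {ρ κ : Type} [Fintype ρ] [Fintype κ] (L : Matrix ρ κ ℝ[X])
    (w : ρ → SmoothModule) :
    (∃ l, matAction L l = w) ↔
      ∀ r : ρ → ℝ[X], Matrix.vecMul r L = 0 → ∑ i, r i • w i = 0 := by
  constructor
  · rintro ⟨l, rfl⟩ r hr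
    simp_rw [matAction_apply, Finset.smul_sum, smul_smul]
    rw [Finset.sum_comm]
    refine Finset.sum_eq_zero fun j _ => ?_
    rw [← Finset.sum_smul]
    exact (congrArg (· • l j) (congrFun hr j)).trans (zero_smul _ _)
  · intro h
    obtain ⟨l, hl⟩ := exists_solution_of_syzygies SmoothModule.baer L w h
    exact ⟨l, funext fun i => (matAction_apply L l i).trans (hl i)⟩

theorem InputSystem.trajectory_mem_inputBehaviour {m : ℕ} (S : InputSystem m)
    (u : Fin m → SmoothModule) :
    trajectory u ∈ S.inputBehaviour ↔ matAction S.E u = 0 := by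
  rw [InputSystem.inputBehaviour, Set.mem_ofPred_eq, and_iff_right (trajectory_mem_cInf u),
    matDiffOp_trajectory, eq_comm, ← trajectory_zero, trajectory_injective.eq_iff]

theorem LatentInputSystem.trajectory_mem_inputBehaviour {m : ℕ} (S : LatentInputSystem m)
    (u : Fin m → SmoothModule) :
    trajectory u ∈ S.inputBehaviour ↔ ∃ l, matAction S.L l = matAction S.M u := by
  rw [LatentInputSystem.inputBehaviour, Set.mem_ofPred_eq, and_iff_right (trajectory_mem_cInf u)]
  constructor
  · rintro ⟨l, hl, h⟩
    obtain ⟨l, rfl⟩ := exists_trajectory_eq hl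
    rw [matDiffOp_trajectory, matDiffOp_trajectory, trajectory_injective.eq_iff] at h
    exact ⟨l, h⟩
  · rintro ⟨l, h⟩
    exact ⟨trajectory l, trajectory_mem_cInf l, by
      rw [matDiffOp_trajectory, matDiffOp_trajectory, h]⟩

theorem ExternalSystem.trajectory_mem_behaviour {m p : ℕ} (S : ExternalSystem m p)
    (u : Fin m → SmoothModule) (y : Fin p → SmoothModule) :
    (trajectory u, trajectory y) ∈ S.behaviour ↔ matAction S.G y = matAction S.H u := by
  rw [ExternalSystem.behaviour, Set.mem_ofPred_eq, and_iff_right (trajectory_mem_cInf u),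
    and_iff_right (trajectory_mem_cInf y), matDiffOp_trajectory, matDiffOp_trajectory,
    trajectory_injective.eq_iff]

/-- Elimination of latent variables. -/
theorem LatentInputSystem.exists_represents {m : ℕ} (T : LatentInputSystem m) :
    ∃ A : InputSystem m, A.Represents T := by
  -- Finitely many generators of the syzygies of `L`, each applied to `M`, give the rows of the
  -- eliminated system.
  obtain ⟨s, hs⟩ := IsNoetherian.noetherian (LinearMap.ker T.L.vecMulLinear)
  refine ⟨⟨s, fun r => Matrix.vecMul r.1 T.M⟩, ?_⟩
  have key (u : Fin m → SmoothModule) (r : T.rows → ℝ[X]) :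
      ∑ j, Matrix.vecMul r T.M j • u j = ∑ i, r i • matAction T.M u i := by
    simp_rw [matAction_apply, Finset.smul_sum, smul_smul, Matrix.vecMul, dotProduct,
      Finset.sum_smul]
    exact Finset.sum_comm
  have main (u : Fin m → SmoothModule) :
      trajectory u ∈ InputSystem.inputBehaviour ⟨s, fun r => Matrix.vecMul r.1 T.M⟩ ↔
        trajectory u ∈ T.inputBehaviour := by
    rw [InputSystem.trajectory_mem_inputBehaviour, LatentInputSystem.trajectory_mem_inputBehaviour,
      exists_matAction_eq_iff]
    constructor
    · intro h r hr
      have hle : LinearMap.ker T.L.vecMulLinear ≤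
          LinearMap.ker (Fintype.linearCombination ℝ[X] (matAction T.M u)) := by
        rw [← hs, Submodule.span_le]
        intro r hr
        have := congrFun h ⟨r, hr⟩
        rw [matAction_apply] at this
        exact (key u r).symm.trans this
      exact hle hr
    · intro h
      ext1 r
      rw [matAction_apply]
      exact (key u r.1).trans (h r.1 (hs.le (Submodule.subset_span r.2)))
  ext u
  constructor
  · intro hu
    obtain ⟨u, rfl⟩ := exists_trajectory_eq hu.1
    exact (main u).mp hu
  · intro hu
    obtain ⟨u, rfl⟩ := exists_trajectory_eq hu.1
    exact (main u).mpr hu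

/-! ### Join, interconnection and meet -/

theorem matAction_join {ρ σ ι : Type} [Fintype ι] [DecidableEq ι] (R : Matrix ρ ι ℝ[X])
    (S : Matrix σ ι ℝ[X]) (l : ι ⊕ ι → SmoothModule) :
    matAction (Matrix.fromRows (Matrix.fromCols 1 1) (Matrix.fromBlocks R 0 0 S)) l =
      Sum.elim (l ∘ Sum.inl + l ∘ Sum.inr)
        (Sum.elim (matAction R (l ∘ Sum.inl)) (matAction S (l ∘ Sum.inr))) := by
  rw [matAction_fromRows, ← Matrix.fromRows_fromCols_eq_fromBlocks, matAction_fromRows,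
    matAction_fromCols, matAction_fromCols, matAction_fromCols, matAction_one, matAction_one,
    matAction_zero, matAction_zero, add_zero, zero_add]

theorem InputSystem.trajectory_mem_join {m : ℕ} (S₁ S₂ : InputSystem m)
    (u : Fin m → SmoothModule) :
    trajectory u ∈ (S₁.join S₂).inputBehaviour ↔
      ∃ u₁ u₂, u₁ + u₂ = u ∧ matAction S₁.E u₁ = 0 ∧ matAction S₂.E u₂ = 0 := by
  have key (l : Fin m ⊕ Fin m → SmoothModule) :
      matAction (S₁.join S₂).L l = matAction (S₁.join S₂).M u ↔
        l ∘ Sum.inl + l ∘ Sum.inr = u ∧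
          matAction S₁.E (l ∘ Sum.inl) = 0 ∧ matAction S₂.E (l ∘ Sum.inr) = 0 := by
    have hM : matAction (S₁.join S₂).M u = Sum.elim u (Sum.elim 0 0) :=
      (matAction_fromRows _ _ _).trans
        (by rw [matAction_one, matAction_zero, Sum.elim_zero_zero])
    rw [hM, ← Sum.elim_eq_iff, ← Sum.elim_eq_iff]
    exact Eq.congr_left (matAction_join S₁.E S₂.E l)
  rw [LatentInputSystem.trajectory_mem_inputBehaviour]
  constructor
  · rintro ⟨l, h⟩
    exact ⟨_, _, (key l).mp h⟩
  · rintro ⟨u₁, u₂, h⟩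
    exact ⟨Sum.elim u₁ u₂, (key _).mpr h⟩

theorem matDiffOp_zero {ρ ι : Type} [Fintype ι] (w : ℝ → ι → ℝ) :
    matDiffOp (0 : Matrix ρ ι ℝ[X]) w = 0 := by
  ext t i
  simp [matDiffOp, diffOp]

theorem matDiffOp_fromRows_eq_iff {ρ σ ι κ : Type} [Fintype ι] [Fintype κ]
    (G₁ : Matrix ρ ι ℝ[X]) (G₂ : Matrix σ ι ℝ[X]) (H₁ : Matrix ρ κ ℝ[X]) (H₂ : Matrix σ κ ℝ[X])
    (y : ℝ → ι → ℝ) (u : ℝ → κ → ℝ) :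
    matDiffOp (Matrix.fromRows G₁ G₂) y = matDiffOp (Matrix.fromRows H₁ H₂) u ↔
      matDiffOp G₁ y = matDiffOp H₁ u ∧ matDiffOp G₂ y = matDiffOp H₂ u := by
  simp only [funext_iff, Sum.forall, matDiffOp, Matrix.fromRows_apply_inl,
    Matrix.fromRows_apply_inr, forall_and]

theorem mem_interconnect_behaviour {m p : ℕ} {E : InputSystem m} {S : ExternalSystem m p}
    {w : (ℝ → Fin m → ℝ) × (ℝ → Fin p → ℝ)} :
    w ∈ (interconnect E S).behaviour ↔ w.1 ∈ E.inputBehaviour ∧ w ∈ S.behaviour := by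
  have h := matDiffOp_fromRows_eq_iff S.G (0 : Matrix E.rows (Fin p) ℝ[X]) S.H E.E w.2 w.1
  rw [matDiffOp_zero] at h
  constructor
  · rintro ⟨hu, hy, he⟩
    exact ⟨⟨hu, (h.mp he).2⟩, hu, hy, (h.mp he).1⟩
  · rintro ⟨⟨hu, h₂⟩, -, hy, h₁⟩
    exact ⟨hu, hy, h.mpr ⟨h₁, h₂⟩⟩

theorem ExternalSystem.behaviour_meet {m p : ℕ} (S₁ S₂ : ExternalSystem m p) :
    (S₁.meet S₂).behaviour = S₁.behaviour ∩ S₂.behaviour := by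
  ext w
  have h := matDiffOp_fromRows_eq_iff S₁.G S₂.G S₁.H S₂.H w.2 w.1
  constructor
  · rintro ⟨hu, hy, he⟩
    exact ⟨⟨hu, hy, (h.mp he).1⟩, hu, hy, (h.mp he).2⟩
  · rintro ⟨⟨hu, hy, h₁⟩, -, -, h₂⟩
    exact ⟨hu, hy, h.mpr ⟨h₁, h₂⟩⟩

/-! ### Contracts and their conjunction -/

/-- It suffices to check an implementation in the largest compatible environment. -/
theorem Contract.implements_iff {m p : ℕ} {C : Contract m p} {S : IOSystem m p} :
    C.Implements S ↔
      (interconnect C.assumptions S.toExternalSystem).behaviour ⊆ C.guarantees.behaviour := by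
  refine ⟨fun h => h _ subset_rfl, fun h E hE w hw => h ?_⟩
  rw [mem_interconnect_behaviour] at hw ⊢
  exact ⟨hE hw.1, hw.2⟩

theorem Contract.refines_iff {m p : ℕ} {C₁ C₂ : Contract m p} :
    C₁.Refines C₂ ↔ C₂.assumptions.inputBehaviour ⊆ C₁.assumptions.inputBehaviour ∧
      ∀ S, C₁.Implements S → C₂.Implements S :=
  and_congr_left fun _ => ⟨fun h => h _ subset_rfl, fun h _ hE => hE.trans h⟩

/-- Invertibility of `P` over the rational functions leaves only the zero syzygy, so the solvability
criterion is vacuous. -/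
theorem IOSystem.exists_output {m p : ℕ} (S : IOSystem m p) (u : Fin m → SmoothModule) :
    ∃ y, matAction S.P y = matAction S.Q u := by
  rw [exists_matAction_eq_iff]
  intro r hr
  obtain ⟨R, hR⟩ := S.invertible
  have hr' : Matrix.vecMul (fun i => algebraMap ℝ[X] (RatFunc ℝ) (r i)) (toRational S.P) = 0 := by
    ext j
    have := congrArg (algebraMap ℝ[X] (RatFunc ℝ)) (congrFun hr j)
    rwa [RingHom.map_vecMul, Pi.zero_apply, map_zero] at this
  have hzero := congrArg (Matrix.vecMul · R) hr'
  simp only [Matrix.vecMul_vecMul, hR, Matrix.vecMul_one, Matrix.zero_vecMul] at hzero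
  refine Finset.sum_eq_zero fun i _ => ?_
  rw [(map_eq_zero_iff _ (RatFunc.algebraMap_injective ℝ)).mp (congrFun hzero i), zero_smul]

/-- The sum of two input behaviours lies in every input behaviour containing both. -/
theorem InputSystem.inputBehaviour_join_subset {m : ℕ} {A₁ A₂ B : InputSystem m}
    (h₁ : A₁.inputBehaviour ⊆ B.inputBehaviour) (h₂ : A₂.inputBehaviour ⊆ B.inputBehaviour) :
    (A₁.join A₂).inputBehaviour ⊆ B.inputBehaviour := by
  intro u hu
  obtain ⟨u, rfl⟩ := exists_trajectory_eq hu.1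
  obtain ⟨u₁, u₂, rfl, hu₁, hu₂⟩ := (trajectory_mem_join A₁ A₂ u).mp hu
  have hB₁ := h₁ ((A₁.trajectory_mem_inputBehaviour u₁).mpr hu₁)
  have hB₂ := h₂ ((A₂.trajectory_mem_inputBehaviour u₂).mpr hu₂)
  rw [trajectory_mem_inputBehaviour] at hB₁ hB₂ ⊢
  rw [map_add, hB₁, hB₂, add_zero]

theorem InputSystem.inputBehaviour_subset_join_left {m : ℕ} (A₁ A₂ : InputSystem m) :
    A₁.inputBehaviour ⊆ (A₁.join A₂).inputBehaviour := by
  intro u hu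
  obtain ⟨u, rfl⟩ := exists_trajectory_eq hu.1
  rw [trajectory_mem_inputBehaviour] at hu
  exact (trajectory_mem_join A₁ A₂ u).mpr ⟨u, 0, add_zero u, hu, map_zero _⟩

theorem InputSystem.inputBehaviour_subset_join_right {m : ℕ} (A₁ A₂ : InputSystem m) :
    A₂.inputBehaviour ⊆ (A₁.join A₂).inputBehaviour := by
  intro u hu
  obtain ⟨u, rfl⟩ := exists_trajectory_eq hu.1
  rw [trajectory_mem_inputBehaviour] at hu
  exact (trajectory_mem_join A₁ A₂ u).mpr ⟨0, u, zero_add u, map_zero _, hu⟩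

/-- Guarantees that a system in input-output form satisfies under each of two assumptions are
satisfied under the join of these assumptions. -/
theorem IOSystem.behaviour_subset_of_represents_join {m p : ℕ} {A₁ A₂ A : InputSystem m}
    (hA : A.Represents (A₁.join A₂)) {S : IOSystem m p} {Γ : ExternalSystem m p}
    (h₁ : (interconnect A₁ S.toExternalSystem).behaviour ⊆ Γ.behaviour)
    (h₂ : (interconnect A₂ S.toExternalSystem).behaviour ⊆ Γ.behaviour) :
    (interconnect A S.toExternalSystem).behaviour ⊆ Γ.behaviour := by
  rintro ⟨u, y⟩ hw
  obtain ⟨u, rfl⟩ := exists_trajectory_eq hw.1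
  obtain ⟨y, rfl⟩ := exists_trajectory_eq hw.2.1
  obtain ⟨hu, hy⟩ := mem_interconnect_behaviour.mp hw
  rw [InputSystem.Represents] at hA
  rw [hA, InputSystem.trajectory_mem_join] at hu
  obtain ⟨u₁, u₂, rfl, hu₁, hu₂⟩ := hu
  replace hy : matAction S.P y = matAction S.Q (u₁ + u₂) :=
    (ExternalSystem.trajectory_mem_behaviour _ _ _).mp hy
  obtain ⟨y₁, hy₁⟩ := S.exists_output u₁
  -- Any output `y₁` for `u₁` will do: by linearity the remainder is an output for `u₂`.
  obtain ⟨y₂, rfl⟩ : ∃ y₂, y₁ + y₂ = y := ⟨y - y₁, add_sub_cancel y₁ y⟩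
  have hy₂ : matAction S.P y₂ = matAction S.Q u₂ := by
    rw [map_add, map_add, hy₁] at hy
    exact add_left_cancel hy
  have hΓ₁ := h₁ (mem_interconnect_behaviour.mpr
    ⟨(A₁.trajectory_mem_inputBehaviour u₁).mpr hu₁,
      (S.toExternalSystem.trajectory_mem_behaviour u₁ y₁).mpr hy₁⟩)
  have hΓ₂ := h₂ (mem_interconnect_behaviour.mpr
    ⟨(A₂.trajectory_mem_inputBehaviour u₂).mpr hu₂,
      (S.toExternalSystem.trajectory_mem_behaviour u₂ y₂).mpr hy₂⟩)
  rw [ExternalSystem.trajectory_mem_behaviour] at hΓ₁ hΓ₂ ⊢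
  rw [map_add, map_add, hΓ₁, hΓ₂]

theorem Contract.isConjunction_of_represents_join {m p : ℕ} {A₁ A₂ A : InputSystem m}
    {Γ₁ Γ₂ : ExternalSystem m p} (hA : A.Represents (A₁.join A₂))
    (h : A₁.inputBehaviour = A₂.inputBehaviour ∨
      (interconnect A Γ₁).behaviour = (interconnect A Γ₂).behaviour) :
    Contract.IsConjunction ⟨A, Γ₁.meet Γ₂⟩ ⟨A₁, Γ₁⟩ ⟨A₂, Γ₂⟩ := by
  have hA₁ : A₁.inputBehaviour ⊆ A.inputBehaviour :=
    (A₁.inputBehaviour_subset_join_left A₂).trans_eq hA.symm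
  have hA₂ : A₂.inputBehaviour ⊆ A.inputBehaviour :=
    (A₁.inputBehaviour_subset_join_right A₂).trans_eq hA.symm
  refine ⟨refines_iff.mpr ⟨hA₁, fun S hS E hE w hw => ?_⟩,
    refines_iff.mpr ⟨hA₂, fun S hS E hE w hw => ?_⟩, fun C' hC₁ hC₂ => ?_⟩
  · exact ((Γ₁.behaviour_meet Γ₂).le (hS E (hE.trans hA₁) hw)).1
  · exact ((Γ₁.behaviour_meet Γ₂).le (hS E (hE.trans hA₂) hw)).2
  · rw [refines_iff] at hC₁ hC₂ ⊢
    refine ⟨hA.le.trans (InputSystem.inputBehaviour_join_subset hC₁.1 hC₂.1), fun S hS => ?_⟩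
    have hS₁ := implements_iff.mp (hC₁.2 S hS)
    have hS₂ := implements_iff.mp (hC₂.2 S hS)
    rw [implements_iff]
    dsimp only at hS₁ hS₂ ⊢
    rw [ExternalSystem.behaviour_meet]
    refine Set.subset_inter (IOSystem.behaviour_subset_of_represents_join hA hS₁ ?_)
      (IOSystem.behaviour_subset_of_represents_join hA ?_ hS₂)
    -- Cross case: `Γ₁` under `A₂`. With equal assumptions this is `hS₁`; otherwise `w` satisfies
    -- `Γ₂` and its input lies in `A`, where the two guarantees agree.
    · intro w hw
      have hw' := mem_interconnect_behaviour.mp hw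
      rcases h with h | h
      · exact hS₁ (mem_interconnect_behaviour.mpr ⟨h.symm.le hw'.1, hw'.2⟩)
      · exact (mem_interconnect_behaviour.mp
          (h.symm.le (mem_interconnect_behaviour.mpr ⟨hA₂ hw'.1, hS₂ hw⟩))).2
    · intro w hw
      have hw' := mem_interconnect_behaviour.mp hw
      rcases h with h | h
      · exact hS₂ (mem_interconnect_behaviour.mpr ⟨h.le hw'.1, hw'.2⟩)
      · exact (mem_interconnect_behaviour.mp
          (h.le (mem_interconnect_behaviour.mpr ⟨hA₁ hw'.1, hS₁ hw⟩))).2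

end LinearContracts

end

theorem mainTheorem4 (m p : ℕ) (A₁ A₂ : LinearContracts.InputSystem m)
    (Γ₁ Γ₂ : LinearContracts.ExternalSystem m p) :
    (∃ A : LinearContracts.InputSystem m, A.Represents (A₁.join A₂)) ∧
    ∀ A : LinearContracts.InputSystem m, A.Represents (A₁.join A₂) →
      (A₁.inputBehaviour = A₂.inputBehaviour ∨
        (LinearContracts.interconnect A Γ₁).behaviour =
          (LinearContracts.interconnect A Γ₂).behaviour) →
      LinearContracts.Contract.IsConjunction ⟨A, Γ₁.meet Γ₂⟩ ⟨A₁, Γ₁⟩ ⟨A₂, Γ₂⟩ :=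
  ⟨LinearContracts.LatentInputSystem.exists_represents _,
    fun _ hA h => LinearContracts.Contract.isConjunction_of_represents_join hA h⟩
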